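/- Let $\mathfrak{A}$ be a unital C$^*$-algebra and let $\tau$ be a faithful tracial state on $\mathfrak{A}$. Assume that $\mathfrak{A}$ has - real rank zero: the invertible self-adjoint elements are norm dense in the self-adjoint elements; - stable rank one: the invertible elements are norm dense in $\mathfrak{A}$; - strong comparison of projections with respect to $\tau$: for all projections $P, Q \in \mathfrak{A}$ with $\tau(P) \le \tau(Q)$ there are a projection $Q' \le Q$ and an element $V \in \mathfrak{A}$ with $P = V^*V$ and $Q' = VV^*$. For $\epsilon > 0$ let $f_\epsilon$ be the continuous function on $[0,\infty)$ that equals $0$ on $[0,\epsilon/2]$, equals $1$ on $[\epsilon,\infty)$ and is linear on $(\epsilon/2,\epsilon)$. For positive $A \in \mathfrak{A}$ put $d_\tau(A) = \lim_{\epsilon \to 0^+} \tau(f_\epsilon(A))$. For $T \in \mathfrak{A}$ with $|T| = (T^*T)^{1/2}$, the singular value function of $T$ associated with $\tau$ is $$\mu^\tau_T(s) = \inf\{t \in \mathbb{R} : d_\tau((|T| - tI_{\mathfrak{A}})_+) \le s\}, \qquad s \in [0,1),$$ where $(\cdot)_+$ denotes the positive part. Then for all $S, T \in \mathfrak{A}$,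 $S$ lies in the norm closure of $\{UTV : U, V \text{ unitaries in } \mathfrak{A}\}$ if and only if $\mu^\tau_S(s) = \mu^\tau_T(s)$ for all $s \in [0,1)$. -/

import Mathlib

open Filter Topology
open scoped ComplexOrder

namespace TracialCStar

section Algebra

variable {A : Type*} [CStarAlgebra A]

/-- Real rank zero: the invertible self-adjoint elements are dense in the self-adjoint elements. -/
def RealRankZero (A : Type*) [CStarAlgebra A] : Prop :=
  {a : A | IsSelfAdjoint a} ⊆ closure {a : A | IsSelfAdjoint a ∧ IsUnit a}

/-- Stable rank one: the invertible elements are dense. -/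
def StableRankOne (A : Type*) [CStarAlgebra A] : Prop :=
  Dense {a : A | IsUnit a}

/-- Murray-von Neumann equivalence of projections. -/
def MvNEquiv (p q : A) : Prop :=
  ∃ v : A, p = star v * v ∧ q = v * star v

/-- The closed two-sided unitary orbit of `T`: the norm closure of all `U * T * V` with
`U` and `V` unitary. -/
def closedTwoSidedUnitaryOrbit (T : A) : Set A :=
  closure {x : A | ∃ U ∈ unitary A, ∃ V ∈ unitary A, x = U * T * V}

variable [PartialOrder A] [StarOrderedRing A]

/-- `p` is Murray-von Neumann equivalent to a subprojection of `q`. -/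
def MvNSub (p q : A) : Prop :=
  ∃ q' : A, IsStarProjection q' ∧ q' ≤ q ∧ MvNEquiv p q'

/-- A faithful tracial state: a positive linear functional of value one at the unit which is
tracial and vanishes at no nonzero `star a * a`. -/
structure IsFaithfulTracialState (τ : A →ₚ[ℂ] ℂ) : Prop where
  map_one : τ 1 = 1
  tracial : ∀ a b : A, τ (a * b) = τ (b * a)
  faithful : ∀ a : A, τ (star a * a) = 0 → a = 0

/-- Strong comparison of projections with respect to `τ`. Values of a positive functional at
projections are real, so they are compared through their real parts. -/
def StrongComparison (τ : A →ₚ[ℂ] ℂ) : Prop :=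
  ∀ p q : A, IsStarProjection p → IsStarProjection q → (τ p).re ≤ (τ q).re → MvNSub p q

end Algebra

/-- For `ε > 0`, the continuous function which is `0` on `[0, ε/2]`, `1` on `[ε, ∞)` and linear
in between. -/
noncomputable def cutoff (ε x : ℝ) : ℝ := max 0 (min 1 (2 * x / ε - 1))

theorem continuous_cutoff (ε : ℝ) : Continuous (cutoff ε) := by
  unfold cutoff
  fun_prop

theorem cutoff_of_le {ε x : ℝ} (hε : 0 < ε) (hx : x ≤ ε / 2) : cutoff ε x = 0 := by
  have h : 2 * x / ε ≤ 1 := by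
    rw [div_le_one hε]
    linarith
  unfold cutoff
  rw [min_eq_right (by linarith), max_eq_left (by linarith)]

theorem cutoff_of_ge {ε x : ℝ} (hε : 0 < ε) (hx : ε ≤ x) : cutoff ε x = 1 := by
  have h : 2 ≤ 2 * x / ε := by
    rw [le_div_iff₀ hε]
    linarith
  unfold cutoff
  rw [min_eq_left (by linarith), max_eq_right (by linarith)]

theorem cutoff_anti {ε δ x : ℝ} (hε : 0 < ε) (hεδ : ε ≤ δ) (hx : 0 ≤ x) :
    cutoff δ x ≤ cutoff ε x := by
  unfold cutoff
  gcongr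

theorem cutoff_le_one (ε x : ℝ) : cutoff ε x ≤ 1 := by
  unfold cutoff
  exact max_le zero_le_one (min_le_left _ _)

section Functions

variable {A : Type*} [CStarAlgebra A] [PartialOrder A] [StarOrderedRing A]

/-- The dimension function associated with `τ`, for positive `a`: the limit as `ε` decreases
to `0` of `τ (f_ε a)`, where `f_ε = cutoff ε`. -/
noncomputable def dimFun (τ : A →ₚ[ℂ] ℂ) (a : A) : ℝ :=
  limUnder (𝓝[>] (0 : ℝ)) (fun ε : ℝ => (τ (cfc (cutoff ε) a)).re)

/-- The limit in the definition of `dimFun` exists for every positive element. -/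
theorem tendsto_dimFun (τ : A →ₚ[ℂ] ℂ) {a : A} (ha : 0 ≤ a) :
    Tendsto (fun ε : ℝ => (τ (cfc (cutoff ε) a)).re) (𝓝[>] (0 : ℝ)) (𝓝 (dimFun τ a)) := by
  have hanti : AntitoneOn (fun ε : ℝ => (τ (cfc (cutoff ε) a)).re) (Set.Ioi (0 : ℝ)) := by
    intro ε hε δ _ hεδ
    have h : cfc (cutoff δ) a ≤ cfc (cutoff ε) a :=
      cfc_mono (fun x hx => cutoff_anti hε hεδ (spectrum_nonneg_of_nonneg ha hx))
        (continuous_cutoff δ).continuousOn (continuous_cutoff ε).continuousOn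
    exact (Complex.le_def.mp (OrderHomClass.mono τ h)).1
  have hbdd : BddAbove ((fun ε : ℝ => (τ (cfc (cutoff ε) a)).re) '' Set.Ioi (0 : ℝ)) := by
    refine ⟨(τ 1).re, ?_⟩
    rintro _ ⟨ε, _, rfl⟩
    have h : cfc (cutoff ε) a ≤ 1 :=
      cfc_le_one (cutoff ε) a (fun x _ => cutoff_le_one ε x)
    exact (Complex.le_def.mp (OrderHomClass.mono τ h)).1
  exact tendsto_nhds_limUnder ⟨_, hanti.tendsto_nhdsGT hbdd⟩

/-- The eigenvalue function of a self-adjoint `a` associated with `τ`, for `s ∈ [0, 1)`. -/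
noncomputable def eigenvalueFun (τ : A →ₚ[ℂ] ℂ) (a : A) (s : ℝ) : ℝ :=
  sInf {t : ℝ | dimFun τ ((a - algebraMap ℝ A t)⁺) ≤ s}

/-- The singular value function of `a` associated with `τ`, for `s ∈ [0, 1)`: the eigenvalue
function of the absolute value `(star a * a) ^ (1/2)`. -/
noncomputable def singularValueFun (τ : A →ₚ[ℂ] ℂ) (a : A) (s : ℝ) : ℝ :=
  eigenvalueFun τ (CFC.abs a) s

end Functions

end TracialCStar

/-!
The orbit condition determines the singular values because, for continuous `f`, the number
`τ (f |x|)` depends continuously on `x` and is constant on the two-sided unitary orbit of `T`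
(`IsFaithfulTracialState.map_cfc_abs_eq`); the distribution tails `dimFun τ (|x| - t)⁺` are computed
from such numbers.

For the converse, stable rank one gives approximate polar decompositions `T ≈ v |T|` with `v`
unitary, so it suffices to show that positive `a` and `b` with the same eigenvalue function are
approximately unitarily equivalent (`exists_unitary_norm_sub_conj_lt`).

Equality of the eigenvalue functions says that the distribution tails of `a` and `b` agree, up to
an arbitrarily small shift of the level. By real rank zero, small self-adjoint perturbations of `a`
and `b` have no spectrum at the points of a given grid of mesh `h`, so that the spectral projections
`P j` and `Q j` for the half-lines beyond the grid points lie in the algebra, and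
`a ≈ h • ∑ j, P j`, `b ≈ h • ∑ j, Q j`. The traces of these projections are controlled by the tails
of `a` and `b` without any error term, by Weyl's monotonicity principle `dimFun_posPart_mono`, which
rests on the operator monotonicity of `x ↦ x / (x + ε)` and on the trace property. Shifting the two
grids against each other makes the traces interlace: `τ (P (j + 1)) ≤ τ (Q j) ≤ τ (P j)`.

Strong comparison and faithfulness of `τ` turn this into an interlacing of projections,
`P (j + 1) ≤ u * Q j * star u ≤ P j` for a single unitary `u`
(`StrongComparison.exists_unitary_interlace`). The sums `∑ j, P j` and `∑ j, u * Q j * star u` then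
differ by at most one in norm, by telescoping, whence `‖a - u * b * star u‖` is of the order of `h`.
-/

namespace TracialCStar

/-! ### Projections and comparison by the trace -/

section Projections

variable {A : Type*} [CStarAlgebra A]

/-- If `star v * v` is a projection, then it is the initial projection of `v`. -/
theorem mul_star_mul_self_of_isStarProjection {v : A} (h : IsStarProjection (star v * v)) :
    v * (star v * v) = v := by
  have h1 : star v * v * (star v * v) = star v * v := h.isIdempotentElem
  have h0 : star (v * (star v * v) - v) * (v * (star v * v) - v) = 0 := by
    have h2 : star (v * (star v * v) - v) * (v * (star v * v) - v) =
        star v * v * (star v * v) * (star v * v) - star v * v * (star v * v)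
          - star v * v * (star v * v) + star v * v := by
      simp only [star_sub, star_mul, star_star]
      noncomm_ring
    rw [h2, h1, h1]
    abel
  exact sub_eq_zero.mp (CStarRing.star_mul_self_eq_zero_iff _ |>.mp h0)

theorem isStarProjection_unitary_conj {p u : A} (hp : IsStarProjection p) (hu : u ∈ unitary A) :
    IsStarProjection (u * p * star u) :=
  hp.map (Unitary.conjStarAlgAut ℂ A ⟨u, hu⟩)

variable [PartialOrder A] {τ : A →ₚ[ℂ] ℂ}

theorem re_map_mono (τ : A →ₚ[ℂ] ℂ) {a b : A} (h : a ≤ b) : (τ a).re ≤ (τ b).re :=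
  (Complex.le_def.mp (OrderHomClass.mono τ h)).1

theorem IsFaithfulTracialState.map_eq_of_mvNEquiv (hτ : IsFaithfulTracialState τ) {p q : A}
    (h : MvNEquiv p q) : τ p = τ q := by
  obtain ⟨v, rfl, rfl⟩ := h
  exact hτ.tracial _ _

theorem IsFaithfulTracialState.map_unitary_conj (hτ : IsFaithfulTracialState τ) {u : A}
    (hu : u ∈ unitary A) (a : A) : τ (u * a * star u) = τ a := by
  rw [hτ.tracial, ← mul_assoc, (Unitary.mem_iff.mp hu).1, one_mul]

theorem re_map_algebraMap (hτ : IsFaithfulTracialState τ) (c : ℝ) :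
    (τ (algebraMap ℝ A c)).re = c := by
  rw [IsScalarTower.algebraMap_apply ℝ ℂ A, Algebra.algebraMap_eq_smul_one, map_smul, hτ.map_one]
  simp

theorem re_map_cfc_smul (τ : A →ₚ[ℂ] ℂ) (c : ℝ) {f : ℝ → ℝ} {a : A}
    (hf : ContinuousOn f (spectrum ℝ a)) :
    (τ (cfc (fun x => c * f x) a)).re = c * (τ (cfc f a)).re := by
  rw [cfc_const_mul c f a hf, ← Complex.coe_smul, map_smul]
  simp

variable [StarOrderedRing A]

/-- A faithful state distinguishes comparable projections. -/
theorem IsFaithfulTracialState.eq_of_le_of_re_map_le (hτ : IsFaithfulTracialState τ) {p q : A}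
    (hp : IsStarProjection p) (hq : IsStarProjection q) (hpq : p ≤ q)
    (h : (τ q).re ≤ (τ p).re) : p = q := by
  have hd := (hp.le_iff_sub hq).mp hpq
  have h0 : τ (q - p) = 0 := by
    have hnn : 0 ≤ τ (q - p) := map_nonneg τ hd.nonneg
    refine le_antisymm (Complex.le_def.mpr ⟨?_, ?_⟩) hnn
    · rw [map_sub, Complex.sub_re, Complex.zero_re]
      linarith
    · exact (Complex.le_def.mp hnn).2.symm
  have h1 : star (q - p) * (q - p) = q - p := by
    rw [hd.isSelfAdjoint.star_eq, hd.isIdempotentElem.eq]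
  exact (sub_eq_zero.mp (hτ.faithful _ (by rw [h1, h0]))).symm

/-- Under strong comparison, projections of equal trace are Murray-von Neumann equivalent. -/
theorem StrongComparison.mvNEquiv (hcomp : StrongComparison τ) (hτ : IsFaithfulTracialState τ)
    {p q : A} (hp : IsStarProjection p) (hq : IsStarProjection q) (h : (τ p).re = (τ q).re) :
    MvNEquiv p q := by
  obtain ⟨q', hq', hle, hv⟩ := hcomp p q hp hq h.le
  have := hτ.eq_of_le_of_re_map_le hq' hq hle (by rw [← hτ.map_eq_of_mvNEquiv hv, h])
  rwa [this] at hv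

/-- Interpolation: between two nested projections there is one of any prescribed intermediate
trace, provided that trace is attained at some projection. -/
theorem StrongComparison.exists_between (hcomp : StrongComparison τ)
    (hτ : IsFaithfulTracialState τ) {p r q : A} (hp : IsStarProjection p)
    (hr : IsStarProjection r) (hq : IsStarProjection q) (hpr : p ≤ r)
    (h₁ : (τ p).re ≤ (τ q).re) (h₂ : (τ q).re ≤ (τ r).re) :
    ∃ s, IsStarProjection s ∧ p ≤ s ∧ s ≤ r ∧ (τ s).re = (τ q).re := by
  obtain ⟨q', hq', hle, hv⟩ := hcomp p q hp hq h₁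
  have htr := hτ.map_eq_of_mvNEquiv hv
  have hqd := (hq'.le_iff_sub hq).mp hle
  have hrd := (hp.le_iff_sub hr).mp hpr
  obtain ⟨s', hs', hle', hv'⟩ := hcomp (q - q') (r - p) hqd hrd (by
    rw [map_sub, map_sub, ← htr, Complex.sub_re, Complex.sub_re]; linarith)
  have htr' := hτ.map_eq_of_mvNEquiv hv'
  have h1 := (hs'.le_iff_mul_eq_right hrd).mp hle'
  have h2 := (hp.le_iff_mul_eq_left hr).mp hpr
  have h0 : p * s' = 0 := by
    rw [← h1, ← mul_assoc, mul_sub, h2, hp.isIdempotentElem.eq, sub_self, zero_mul]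
  refine ⟨p + s', hp.add hs' h0, le_add_of_nonneg_right hs'.nonneg, ?_, ?_⟩
  · calc p + s' ≤ p + (r - p) := by gcongr
      _ = r := by abel
  · rw [map_add, ← htr', map_sub, ← htr]
    simp

/-- Projections of equal trace below a projection `e` are conjugate by a unitary which acts
trivially on the complement of `e`, and so commutes with every projection above `e`. -/
theorem StrongComparison.exists_unitary_conj (hcomp : StrongComparison τ)
    (hτ : IsFaithfulTracialState τ) {p q e : A} (hp : IsStarProjection p)
    (hq : IsStarProjection q) (he : IsStarProjection e) (hpe : p ≤ e) (hqe : q ≤ e)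
    (h : (τ p).re = (τ q).re) :
    ∃ u ∈ unitary A, u * p * star u = q ∧
      ∀ f, IsStarProjection f → e ≤ f → u * f * star u = f := by
  have hpd := (hp.le_iff_sub he).mp hpe
  have hqd := (hq.le_iff_sub he).mp hqe
  obtain ⟨v, hv1, hv2⟩ := hcomp.mvNEquiv hτ hp hq h
  obtain ⟨w, hw1, hw2⟩ := hcomp.mvNEquiv hτ hpd hqd (by
    rw [map_sub, map_sub, Complex.sub_re, Complex.sub_re, h])
  have hvp : v * p = v := by
    rw [hv1]; exact mul_star_mul_self_of_isStarProjection (hv1 ▸ hp)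
  have hwp : w * (e - p) = w := by
    rw [hw1]; exact mul_star_mul_self_of_isStarProjection (hw1 ▸ hpd)
  have hqv : q * v = v := by
    rw [hv2, mul_assoc, ← hv1, hvp]
  have hqw : (e - q) * w = w := by
    rw [hw2, mul_assoc, ← hw1, hwp]
  have hpe1 := (hp.le_iff_mul_eq_left he).mp hpe
  have hpe2 := (hp.le_iff_mul_eq_right he).mp hpe
  have hqe1 := (hq.le_iff_mul_eq_left he).mp hqe
  have hqe2 := (hq.le_iff_mul_eq_right he).mp hqe
  have hpp := hp.isIdempotentElem.eq
  have hqq := hq.isIdempotentElem.eq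
  have hee := he.isIdempotentElem.eq
  have hps := hp.isSelfAdjoint.star_eq
  have hqs := hq.isSelfAdjoint.star_eq
  have hes := he.isSelfAdjoint.star_eq
  have hwp0 : w * p = 0 := by rw [← hwp, mul_assoc, sub_mul, hpe2, hpp, sub_self, mul_zero]
  have hqw0 : q * w = 0 := by rw [← hqw, ← mul_assoc, mul_sub, hqe1, hqq, sub_self, zero_mul]
  have hve : v * e = v := by rw [← hvp, mul_assoc, hpe1]
  have hev : e * v = v := by rw [← hqv, ← mul_assoc, hqe2]
  have hwe : w * e = w := by rw [← hwp, mul_assoc, sub_mul, hee, hpe1]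
  have hew : e * w = w := by rw [← hqw, ← mul_assoc, mul_sub, hee, hqe2]
  have hpv' : p * star v = star v := by simpa [hps] using congr(star $hvp)
  have hqv' : star v * q = star v := by simpa [hqs] using congr(star $hqv)
  have hpw' : p * star w = 0 := by simpa [hps] using congr(star $hwp0)
  have hqw' : star w * q = 0 := by simpa [hqs] using congr(star $hqw0)
  have hev' : e * star v = star v := by simpa [hes] using congr(star $hve)
  have hve' : star v * e = star v := by simpa [hes] using congr(star $hev)
  have hew' : e * star w = star w := by simpa [hes] using congr(star $hwe)
  have hwe' : star w * e = star w := by simpa [hes] using congr(star $hew)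
  have hvw : star v * w = 0 := by rw [← hqv', mul_assoc, hqw0, mul_zero]
  have hwv : star w * v = 0 := by rw [← hqv, ← mul_assoc, hqw', zero_mul]
  have hvw' : v * star w = 0 := by rw [← hvp, mul_assoc, hpw', mul_zero]
  have hwv' : w * star v = 0 := by rw [← hpv', ← mul_assoc, hwp0, zero_mul]
  -- The unitary is the identity off `e` plus the two partial isometries `v : p → q` and
  -- `w : e - p → e - q`.
  have hu : (1 - e) + v + w ∈ unitary A := by
    rw [Unitary.mem_iff]
    constructor
    · simp only [star_add, star_sub, star_one, hes, add_mul, mul_add, sub_mul, mul_sub, one_mul,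
        mul_one, hee, hev, hew, hve', hwe', hvw, hwv, ← hv1, ← hw1]
      abel
    · simp only [star_add, star_sub, star_one, hes, add_mul, mul_add, sub_mul, mul_sub, one_mul,
        mul_one, hee, hev', hew', hve, hwe, hvw', hwv', ← hv2, ← hw2]
      abel
  refine ⟨_, hu, ?_, fun f hf hef => ?_⟩
  · have : (1 - e + v + w) * p = v := by
      simp only [add_mul, sub_mul, one_mul, hpe2, hvp, hwp0]; abel
    rw [this]
    simp only [star_add, star_sub, star_one, hes, mul_add, mul_sub, mul_one, hve, hvw', ← hv2]
    abel
  · have hef1 := (he.le_iff_mul_eq_left hf).mp hef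
    have hef2 := (he.le_iff_mul_eq_right hf).mp hef
    have hvf : v * f = v := by rw [← hve, mul_assoc, hef1]
    have hfv : f * v = v := by rw [← hev, ← mul_assoc, hef2]
    have hwf : w * f = w := by rw [← hwe, mul_assoc, hef1]
    have hfw : f * w = w := by rw [← hew, ← mul_assoc, hef2]
    have hcomm : (1 - e + v + w) * f = f * (1 - e + v + w) := by
      simp only [add_mul, sub_mul, mul_add, mul_sub, one_mul, mul_one, hef1, hef2, hvf, hfv,
        hwf, hfw]
    rw [hcomm, mul_assoc, (Unitary.mem_iff.mp hu).2, mul_one]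

/-- Two decreasing sequences of projections with interlacing traces can be interlaced, up to any
finite stage, by a single unitary conjugation. -/
theorem StrongComparison.exists_unitary_interlace (hcomp : StrongComparison τ)
    (hτ : IsFaithfulTracialState τ) {P Q : ℕ → A} (hP : ∀ j, IsStarProjection (P j))
    (hQ : ∀ j, IsStarProjection (Q j)) (hPa : Antitone P) (hQa : Antitone Q)
    (h₁ : ∀ j, (τ (P (j + 1))).re ≤ (τ (Q j)).re) (h₂ : ∀ j, (τ (Q j)).re ≤ (τ (P j)).re)
    (n : ℕ) :
    ∃ u ∈ unitary A, ∀ j < n, P (j + 1) ≤ u * Q j * star u ∧ u * Q j * star u ≤ P j := by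
  induction n with
  | zero => exact ⟨1, one_mem _, fun j hj => absurd hj (Nat.not_lt_zero j)⟩
  | succ n ih =>
    obtain ⟨u, hu, hI⟩ := ih
    have hQu j := isStarProjection_unitary_conj (hQ j) hu
    -- `e` is the last projection already in place; everything new happens below it.
    obtain ⟨e, he, hPe, hQe, hefix⟩ : ∃ e, IsStarProjection e ∧ P n ≤ e ∧
        u * Q n * star u ≤ e ∧ ∀ j < n, e ≤ u * Q j * star u := by
      cases n with
      | zero => exact ⟨1, .one A, (hP 0).le_one, (hQu 0).le_one, by simp⟩
      | succ m =>
        refine ⟨u * Q m * star u, hQu m, (hI m (Nat.lt_succ_self m)).1, ?_, fun j hj => ?_⟩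
        · exact star_right_conjugate_le_conjugate (hQa (Nat.le_succ m)) u
        · exact star_right_conjugate_le_conjugate (hQa (Nat.lt_succ_iff.mp hj)) u
    obtain ⟨s, hs, hs1, hs2, hs3⟩ := hcomp.exists_between hτ (hP (n + 1)) (hP n) (hQ n)
      (hPa (Nat.le_succ n)) (h₁ n) (h₂ n)
    obtain ⟨v, hv, hv1, hv2⟩ := hcomp.exists_unitary_conj hτ (hQu n) hs he hQe (hs2.trans hPe)
      (by rw [hτ.map_unitary_conj hu, hs3])
    refine ⟨v * u, mul_mem hv hu, fun j hj => ?_⟩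
    have hassoc : v * u * Q j * star (v * u) = v * (u * Q j * star u) * star v := by
      simp only [star_mul, mul_assoc]
    rw [hassoc]
    rcases Nat.lt_succ_iff_lt_or_eq.mp hj with hj | rfl
    · rw [hv2 _ (hQu j) (hefix j hj)]
      exact hI j hj
    · rw [hv1]
      exact ⟨hs1, hs2⟩

end Projections

/-! ### The dimension function -/

section Dimension

variable {A : Type*} [CStarAlgebra A] [PartialOrder A] [StarOrderedRing A]

theorem continuousOn_div_add {ε : ℝ} (hε : 0 < ε) {a : A} (ha : 0 ≤ a) :
    ContinuousOn (fun x : ℝ => x / (x + ε)) (spectrum ℝ a) := by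
  refine ContinuousOn.div (by fun_prop) (by fun_prop) fun x hx => ?_
  have := spectrum_nonneg_of_nonneg ha hx
  positivity

theorem isUnit_add_algebraMap {ε : ℝ} (hε : 0 < ε) {a : A} (ha : 0 ≤ a) :
    IsUnit (a + algebraMap ℝ A ε) :=
  (IsStrictlyPositive.nonneg_add ha (isStrictlyPositive_algebraMap hε)).isUnit

theorem cfc_div_add_mul {ε : ℝ} (hε : 0 < ε) {a : A} (ha : 0 ≤ a) :
    cfc (fun x : ℝ => x / (x + ε)) a * (a + algebraMap ℝ A ε) = a := by
  have h1 : a + algebraMap ℝ A ε = cfc (fun x : ℝ => x + ε) a := by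
    rw [cfc_add_const ε (fun x => x) a, cfc_id' ℝ a]
  rw [h1, ← cfc_mul _ _ a (continuousOn_div_add hε ha) (by fun_prop)]
  conv_rhs => rw [← cfc_id' ℝ a]
  refine cfc_congr fun x hx => ?_
  have := spectrum_nonneg_of_nonneg ha hx
  exact div_mul_cancel₀ _ (by positivity)

theorem cfc_div_add_unique {ε : ℝ} (hε : 0 < ε) {a b : A} (ha : 0 ≤ a)
    (h : b * (a + algebraMap ℝ A ε) = a) : cfc (fun x : ℝ => x / (x + ε)) a = b :=
  (isUnit_add_algebraMap hε ha).mul_right_cancel ((cfc_div_add_mul hε ha).trans h.symm)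

/-- The functions `x ↦ x / (x + ε)` are operator monotone, since
`x / (x + ε) = 1 - ε / (x + ε)`. -/
theorem cfc_div_add_mono {ε : ℝ} (hε : 0 < ε) {a b : A} (ha : 0 ≤ a) (hab : a ≤ b) :
    cfc (fun x : ℝ => x / (x + ε)) a ≤ cfc (fun x : ℝ => x / (x + ε)) b := by
  have key : ∀ c : A, 0 ≤ c → cfc (fun x : ℝ => x / (x + ε)) c =
      1 - ε • Ring.inverse (c + algebraMap ℝ A ε) := fun c hc => by
    refine cfc_div_add_unique hε hc ?_
    rw [sub_mul, one_mul, smul_mul_assoc,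
      Ring.inverse_mul_cancel _ (isUnit_add_algebraMap hε hc), Algebra.algebraMap_eq_smul_one]
    abel
  rw [key a ha, key b (ha.trans hab)]
  have hpos : IsStrictlyPositive (a + algebraMap ℝ A ε) := by
    refine IsStrictlyPositive.iff_of_unital.mpr ⟨?_, isUnit_add_algebraMap hε ha⟩
    exact add_nonneg ha (algebraMap_nonneg A hε.le)
  have := CStarAlgebra.ringInverse_le_ringInverse
    (add_le_add_left hab (algebraMap ℝ A ε)) hpos
  gcongr

variable {τ : A →ₚ[ℂ] ℂ}

theorem IsFaithfulTracialState.map_cfc_div_add_star_mul_self (hτ : IsFaithfulTracialState τ)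
    {ε : ℝ} (hε : 0 < ε) (z : A) :
    τ (cfc (fun x : ℝ => x / (x + ε)) (star z * z)) =
      τ (cfc (fun x : ℝ => x / (x + ε)) (z * star z)) := by
  have hu := isUnit_add_algebraMap hε (mul_star_self_nonneg z)
  set r := Ring.inverse (z * star z + algebraMap ℝ A ε) with hr
  have hrl : r * (z * star z + algebraMap ℝ A ε) = 1 := Ring.inverse_mul_cancel _ hu
  have hc := Algebra.commutes (R := ℝ) (A := A) ε
  have h1 : cfc (fun x : ℝ => x / (x + ε)) (star z * z) = star z * r * z := by
    refine cfc_div_add_unique hε (star_mul_self_nonneg z) ?_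
    calc star z * r * z * (star z * z + algebraMap ℝ A ε)
        = star z * (r * (z * star z + algebraMap ℝ A ε)) * z := by
          simp only [mul_add, add_mul, mul_assoc, hc]
      _ = star z * z := by rw [hrl, mul_one]
  have h2 : cfc (fun x : ℝ => x / (x + ε)) (z * star z) = r * (z * star z) := by
    refine cfc_div_add_unique hε (mul_star_self_nonneg z) ?_
    calc r * (z * star z) * (z * star z + algebraMap ℝ A ε)
        = r * (z * star z + algebraMap ℝ A ε) * (z * star z) := by
          simp only [mul_add, add_mul, mul_assoc, hc]
      _ = z * star z := by rw [hrl, one_mul]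
  rw [h1, h2, mul_assoc, hτ.tracial, mul_assoc]

theorem re_map_cfc_cutoff_le_dimFun (τ : A →ₚ[ℂ] ℂ) {a : A} (ha : 0 ≤ a) {ε : ℝ} (hε : 0 < ε) :
    (τ (cfc (cutoff ε) a)).re ≤ dimFun τ a := by
  refine ge_of_tendsto (tendsto_dimFun τ ha) ?_
  filter_upwards [Ioo_mem_nhdsGT hε] with δ hδ
  exact re_map_mono τ (cfc_mono (fun x hx => cutoff_anti hδ.1 hδ.2.le
    (spectrum_nonneg_of_nonneg ha hx)) (continuous_cutoff ε).continuousOn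
    (continuous_cutoff δ).continuousOn)

theorem dimFun_le_of_forall_cutoff (τ : A →ₚ[ℂ] ℂ) {a : A} (ha : 0 ≤ a) {C : ℝ}
    (h : ∀ ε > 0, (τ (cfc (cutoff ε) a)).re ≤ C) : dimFun τ a ≤ C := by
  refine le_of_tendsto (tendsto_dimFun τ ha) ?_
  filter_upwards [self_mem_nhdsWithin] with ε hε
  exact h ε hε

theorem dimFun_le_one (hτ : IsFaithfulTracialState τ) {a : A} (ha : 0 ≤ a) :
    dimFun τ a ≤ 1 := by
  refine dimFun_le_of_forall_cutoff τ ha fun ε _ => ?_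
  have := re_map_mono τ (cfc_le_one (cutoff ε) a (fun x _ => cutoff_le_one ε x))
  rwa [hτ.map_one, Complex.one_re] at this

/-- The dimension function is the supremum of the traces of the elements `a * (a + ε)⁻¹`. These
are preferable to the piecewise linear cutoffs because they are operator monotone and algebraic
in `a`. -/
theorem dimFun_le_iff (hτ : IsFaithfulTracialState τ) {a : A} (ha : 0 ≤ a) {C : ℝ} :
    dimFun τ a ≤ C ↔ ∀ ε > 0, (τ (cfc (fun x : ℝ => x / (x + ε)) a)).re ≤ C := by
  constructor
  · intro h ε hε
    refine le_of_forall_pos_le_add fun δ hδ => ?_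
    have hle : cfc (fun x : ℝ => x / (x + ε)) a ≤ cfc (fun x => cutoff (ε * δ) x + δ) a := by
      refine cfc_mono (fun x hx => ?_) (continuousOn_div_add hε ha)
        ((continuous_cutoff _).continuousOn.add continuousOn_const)
      have hx0 := spectrum_nonneg_of_nonneg ha hx
      rcases le_total (ε * δ) x with h1 | h1
      · rw [cutoff_of_ge (by positivity) h1]
        have : x / (x + ε) ≤ 1 := by
          rw [div_le_one (by positivity)]
          linarith
        linarith
      · have h2 : x / (x + ε) ≤ δ := by
          rw [div_le_iff₀ (by positivity)]
          nlinarith [mul_nonneg hδ.le hx0]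
        have h3 : 0 ≤ cutoff (ε * δ) x := le_max_left _ _
        linarith
    have h1 := re_map_mono τ hle
    rw [cfc_add_const δ (cutoff (ε * δ)) a (continuous_cutoff _).continuousOn, map_add,
      Complex.add_re, re_map_algebraMap hτ] at h1
    have h2 := re_map_cfc_cutoff_le_dimFun τ ha (mul_pos hε hδ)
    linarith
  · intro h
    refine dimFun_le_of_forall_cutoff τ ha fun ε hε => ?_
    have hlim : Tendsto (fun δ : ℝ => (1 + δ) * C) (𝓝[>] 0) (𝓝 C) := by
      have : Tendsto (fun δ : ℝ => (1 + δ) * C) (𝓝 0) (𝓝 ((1 + 0) * C)) :=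
        Continuous.tendsto (by fun_prop) 0
      rw [add_zero, one_mul] at this
      exact this.mono_left nhdsWithin_le_nhds
    refine ge_of_tendsto hlim ?_
    filter_upwards [self_mem_nhdsWithin] with δ hδ
    have hδ : 0 < δ := hδ
    have hη : 0 < δ * (ε / 2) := by positivity
    have hle : cfc (cutoff ε) a ≤ cfc (fun x => (1 + δ) * (x / (x + δ * (ε / 2)))) a := by
      refine cfc_mono (fun x hx => ?_) (continuous_cutoff _).continuousOn
        (continuousOn_const.mul (continuousOn_div_add hη ha))
      have hx0 := spectrum_nonneg_of_nonneg ha hx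
      rcases le_total x (ε / 2) with h1 | h1
      · rw [cutoff_of_le hε h1]
        positivity
      · refine (cutoff_le_one ε x).trans ?_
        rw [mul_div_assoc', le_div_iff₀ (by positivity)]
        nlinarith
    have h1 := re_map_mono τ hle
    rw [re_map_cfc_smul τ (1 + δ) (continuousOn_div_add hη ha)] at h1
    exact h1.trans (mul_le_mul_of_nonneg_left (h _ hη) (by positivity))

theorem dimFun_mono (hτ : IsFaithfulTracialState τ) {a b : A} (ha : 0 ≤ a) (hab : a ≤ b) :
    dimFun τ a ≤ dimFun τ b :=
  (dimFun_le_iff hτ ha).mpr fun _ hε => (re_map_mono τ (cfc_div_add_mono hε ha hab)).trans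
    ((dimFun_le_iff hτ (ha.trans hab)).mp le_rfl _ hε)

theorem dimFun_star_mul_self_le (hτ : IsFaithfulTracialState τ) (z : A) :
    dimFun τ (star z * z) ≤ dimFun τ (z * star z) := by
  refine (dimFun_le_iff hτ (star_mul_self_nonneg z)).mpr fun ε hε => ?_
  rw [hτ.map_cfc_div_add_star_mul_self hε]
  exact (dimFun_le_iff hτ (mul_star_self_nonneg z)).mp le_rfl _ hε

/-- The dimension function does not decrease under a continuous function which is bounded away
from zero away from zero. -/
theorem dimFun_le_dimFun_cfc (τ : A →ₚ[ℂ] ℂ) {a : A} (ha : 0 ≤ a) {f : ℝ → ℝ}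
    (hf : Continuous f) (hf0 : ∀ x, 0 ≤ x → 0 ≤ f x)
    (h : ∀ ε > 0, ∃ δ > 0, ∀ x, ε ≤ x → δ ≤ f x) : dimFun τ a ≤ dimFun τ (cfc f a) := by
  have hfa : 0 ≤ cfc f a := cfc_nonneg fun x hx => hf0 x (spectrum_nonneg_of_nonneg ha hx)
  refine dimFun_le_of_forall_cutoff τ ha fun ε hε => ?_
  obtain ⟨δ, hδ, hfδ⟩ := h (ε / 2) (half_pos hε)
  refine le_trans (re_map_mono τ ?_) (re_map_cfc_cutoff_le_dimFun τ hfa hδ)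
  rw [← cfc_comp' (cutoff δ) f a (continuous_cutoff δ).continuousOn hf.continuousOn]
  refine cfc_mono (fun x _ => ?_) (continuous_cutoff ε).continuousOn
    ((continuous_cutoff δ).comp hf).continuousOn
  rcases le_total x (ε / 2) with h1 | h1
  · rw [cutoff_of_le hε h1]
    exact le_max_left _ _
  · rw [cutoff_of_ge hδ (hfδ x h1)]
    exact cutoff_le_one ε x

theorem dimFun_smul_le (τ : A →ₚ[ℂ] ℂ) {a : A} (ha : 0 ≤ a) {c : ℝ} (hc : 0 < c) :
    dimFun τ (c • a) ≤ dimFun τ a := by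
  have hca : 0 ≤ c • a := smul_nonneg hc.le ha
  refine (dimFun_le_dimFun_cfc τ hca (f := fun x => c⁻¹ * x) (by fun_prop)
    (fun x hx => by positivity) fun ε hε => ⟨c⁻¹ * ε, by positivity, fun x hx => by gcongr⟩).trans
    (le_of_eq ?_)
  rw [cfc_const_mul c⁻¹ (fun x => x) (c • a), cfc_id' ℝ (c • a), smul_smul,
    inv_mul_cancel₀ hc.ne', one_smul]

/-- Weyl's monotonicity principle for the dimension of the positive part: if `a ≤ b`, then
`u³ ≤ u * b⁺ * u` for `u = a⁺`, and the right-hand side has the dimension of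
`(b⁺)^(1/2) * u² * (b⁺)^(1/2)`, which is dominated by a multiple of `b⁺`. -/
theorem dimFun_posPart_mono (hτ : IsFaithfulTracialState τ) {a b : A} (ha : IsSelfAdjoint a)
    (hb : IsSelfAdjoint b) (hab : a ≤ b) : dimFun τ a⁺ ≤ dimFun τ b⁺ := by
  have hu : 0 ≤ a⁺ := CFC.posPart_nonneg a
  have hv : 0 ≤ b⁺ := CFC.posPart_nonneg b
  have hus : star a⁺ = a⁺ := hu.star_eq
  set s := CFC.sqrt b⁺ with hs
  have hss : star s = s := (CFC.sqrt_nonneg b⁺).star_eq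
  have hs2 : s * s = b⁺ := CFC.sqrt_mul_sqrt_self b⁺
  have hbb : b ≤ b⁺ := CFC.le_posPart hb
  have hcube : a⁺ ^ 3 = star a⁺ * a * a⁺ := by
    have h1 : a⁺ - a⁻ = a := CFC.posPart_sub_negPart a
    have h2 : a⁻ * a⁺ = 0 := CFC.negPart_mul_posPart a
    rw [hus]
    nth_rw 3 [← h1]
    rw [mul_sub, sub_mul, mul_assoc _ _ a⁺, mul_assoc _ a⁻, h2, mul_zero, sub_zero, pow_succ, sq,
      mul_assoc]
  have h3 : a⁺ ^ 3 = cfc (fun x : ℝ => x ^ 3) a⁺ := by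
    rw [cfc_pow (fun x : ℝ => x) 3 a⁺, cfc_id' ℝ a⁺]
  have hc : 0 < ‖a⁺ * a⁺‖ + 1 := by positivity
  calc dimFun τ a⁺ ≤ dimFun τ (cfc (fun x : ℝ => x ^ 3) a⁺) :=
        dimFun_le_dimFun_cfc τ hu (by fun_prop) (fun x hx => by positivity)
          fun ε hε => ⟨ε ^ 3, by positivity, fun x hx => by gcongr⟩
    _ = dimFun τ (a⁺ ^ 3) := by rw [h3]
    _ ≤ dimFun τ (star (s * a⁺) * (s * a⁺)) := by
        refine dimFun_mono hτ (CStarAlgebra.pow_nonneg hu 3) ?_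
        have : star (s * a⁺) * (s * a⁺) = star a⁺ * b⁺ * a⁺ := by
          rw [star_mul, hss, ← hs2]
          simp only [mul_assoc]
        rw [this, hcube]
        exact star_left_conjugate_le_conjugate (hab.trans hbb) _
    _ ≤ dimFun τ (s * a⁺ * star (s * a⁺)) := dimFun_star_mul_self_le hτ _
    _ ≤ dimFun τ ((‖a⁺ * a⁺‖ + 1) • b⁺) := by
        refine dimFun_mono hτ (mul_star_self_nonneg _) ?_
        have h1 : s * a⁺ * star (s * a⁺) = s * (a⁺ * a⁺) * star s := by
          rw [star_mul, hus]
          simp only [mul_assoc]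
        rw [h1]
        have h2 : IsSelfAdjoint (a⁺ * a⁺) := by
          rw [IsSelfAdjoint, star_mul, hus]
        have h4 := CStarAlgebra.star_right_conjugate_le_norm_smul (a := s) h2
        refine h4.trans ?_
        rw [hss, hs2, add_smul, one_smul]
        exact le_add_of_nonneg_right hv
    _ ≤ dimFun τ b⁺ := dimFun_smul_le τ hv hc

end Dimension

/-! ### Spectral projections and approximate unitary equivalence -/

section Spectral

variable {A : Type*} [CStarAlgebra A]

/-- The spectral projection of a self-adjoint `a` for the half-line `(t, ∞)`. It is only used for
`t` outside the spectrum of `a`, where the indicator function is continuous on the spectrum. -/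
noncomputable def specProj (t : ℝ) (a : A) : A :=
  cfc (fun x : ℝ => if t < x then (1 : ℝ) else 0) a

theorem continuousOn_ite_lt {t : ℝ} {s : Set ℝ} (ht : t ∉ s) :
    ContinuousOn (fun x : ℝ => if t < x then (1 : ℝ) else 0) s := by
  intro x hx
  refine ContinuousAt.continuousWithinAt ?_
  rcases lt_or_gt_of_ne (fun h : x = t => ht (h ▸ hx)) with h | h
  · refine (continuousAt_const (y := (0 : ℝ))).congr ?_
    filter_upwards [Iio_mem_nhds h] with y hy
    exact (if_neg (not_lt.mpr (le_of_lt hy))).symm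
  · refine (continuousAt_const (y := (1 : ℝ))).congr ?_
    filter_upwards [Ioi_mem_nhds h] with y hy
    exact (if_pos hy).symm

theorem isStarProjection_specProj {t : ℝ} {a : A} (ht : t ∉ spectrum ℝ a) :
    IsStarProjection (specProj t a) where
  isIdempotentElem := by
    have hc := continuousOn_ite_lt ht
    rw [IsIdempotentElem, specProj, ← cfc_mul _ _ a hc hc]
    exact cfc_congr fun x _ => by split_ifs <;> simp
  isSelfAdjoint := cfc_predicate _ a

theorem specProj_anti [PartialOrder A] [StarOrderedRing A] {t t' : ℝ} {a : A} (h : t ≤ t')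
    (ht : t ∉ spectrum ℝ a) (ht' : t' ∉ spectrum ℝ a) : specProj t' a ≤ specProj t a := by
  refine cfc_mono (fun x _ => ?_) (continuousOn_ite_lt ht') (continuousOn_ite_lt ht)
  split_ifs with h1 h2 h2
  · exact le_rfl
  · exact absurd (h.trans_lt h1) h2
  · exact zero_le_one
  · exact le_rfl

/-- A number `y - c` in `[0, n * h]` is approximated, up to `h`, by `h` times the number of points
`c`, `c + h`, … below `y`; values in `[-e, 0]` add an error of at most `e`. -/
theorem abs_sub_sum_ite_le {h c y e : ℝ} (hh : 0 < h) (he : 0 ≤ e) (n : ℕ) (hy : -e ≤ y - c)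
    (hn : y - c ≤ n * h) :
    |y - c - ∑ j ∈ Finset.range n, h * (if c + j * h < y then (1 : ℝ) else 0)| ≤ h + e := by
  have key : ∀ m : ℕ, min (y - c) (m * h) ≤
        ∑ j ∈ Finset.range m, h * (if c + j * h < y then (1 : ℝ) else 0) ∧
      ∑ j ∈ Finset.range m, h * (if c + j * h < y then (1 : ℝ) else 0) ≤ m * h ∧
      ∑ j ∈ Finset.range m, h * (if c + j * h < y then (1 : ℝ) else 0) ≤ max (y - c + h) 0 := by
    intro m
    induction m with
    | zero => simp
    | succ m ih =>
      obtain ⟨h1, h2, h3⟩ := ih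
      rw [Finset.sum_range_succ]
      push_cast
      split_ifs with hlt
      · rw [min_eq_right (by linarith)] at h1
        refine ⟨(min_le_right _ _).trans (by linarith), by linarith, le_max_of_le_left ?_⟩
        linarith
      · rw [min_eq_left (by linarith)] at h1
        rw [mul_zero, add_zero]
        exact ⟨(min_le_left _ _).trans h1, by linarith, h3⟩
  obtain ⟨h1, -, h3⟩ := key n
  rw [min_eq_left hn] at h1
  rw [abs_le]
  constructor
  · rcases max_cases (y - c + h) 0 with ⟨h4, -⟩ | ⟨h4, -⟩ <;> rw [h4] at h3 <;> linarith
  · linarith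

/-- If the grid `c + ℕ h` avoids the spectrum of `a`, then `a` is approximated by the
corresponding sum of spectral projections. -/
theorem norm_sub_sum_specProj_le {a : A} (ha : IsSelfAdjoint a) {h c e : ℝ} (hh : 0 < h)
    (he : 0 ≤ e) (hc : 0 ≤ c) (hgap : ∀ j : ℕ, c + j * h ∉ spectrum ℝ a) (n : ℕ)
    (hlo : ∀ x ∈ spectrum ℝ a, c - e ≤ x) (hhi : ∀ x ∈ spectrum ℝ a, x ≤ c + n * h) :
    ‖a - h • ∑ j ∈ Finset.range n, specProj (c + j * h) a‖ ≤ c + h + e := by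
  have hcont : ∀ j : ℕ, ContinuousOn
      (fun x : ℝ => h * (if c + j * h < x then (1 : ℝ) else 0)) (spectrum ℝ a) :=
    fun j => continuousOn_const.mul (continuousOn_ite_lt (hgap j))
  have hsum : h • ∑ j ∈ Finset.range n, specProj (c + j * h) a =
      cfc (fun x : ℝ => ∑ j ∈ Finset.range n, h * (if c + j * h < x then (1 : ℝ) else 0)) a := by
    have h1 := cfc_sum (fun (j : ℕ) (x : ℝ) => h * (if c + j * h < x then (1 : ℝ) else 0)) a
      (Finset.range n) (fun j _ => hcont j)
    rw [← Finset.sum_fn, h1, Finset.smul_sum]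
    refine Finset.sum_congr rfl fun j _ => ?_
    rw [cfc_const_mul h _ a (continuousOn_ite_lt (hgap j)), specProj]
  have hsub : a - h • ∑ j ∈ Finset.range n, specProj (c + j * h) a = cfc (fun x : ℝ => x -
      ∑ j ∈ Finset.range n, h * (if c + j * h < x then (1 : ℝ) else 0)) a := by
    rw [hsum, cfc_sub (fun x => x) _ a continuousOn_id (continuousOn_finsetSum _ fun j _ =>
      hcont j), cfc_id' ℝ a]
  rw [hsub]
  refine norm_cfc_le (by positivity) fun x hx => ?_
  have := abs_sub_sum_ite_le (c := c) (y := x) hh he n (by linarith [hlo x hx])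
    (by linarith [hhi x hx])
  rw [Real.norm_eq_abs]
  calc |x - ∑ j ∈ Finset.range n, h * (if c + j * h < x then (1 : ℝ) else 0)|
      = |c + (x - c - ∑ j ∈ Finset.range n, h * (if c + j * h < x then (1 : ℝ) else 0))| := by
        congr 1; ring
    _ ≤ |c| + |x - c - ∑ j ∈ Finset.range n, h * (if c + j * h < x then (1 : ℝ) else 0)| :=
        abs_add_le _ _
    _ ≤ c + h + e := by rw [abs_of_nonneg hc]; linarith

/-- In real rank zero, any finite set of reals can be removed from the spectrum of a self-adjoint
element by an arbitrarily small self-adjoint perturbation: each of the conditions is open and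
dense. -/
theorem RealRankZero.exists_norm_sub_lt_notMem_spectrum (hRR : RealRankZero A) {a : A}
    (ha : IsSelfAdjoint a) {δ : ℝ} (hδ : 0 < δ) (t : ℕ → ℝ) (n : ℕ) :
    ∃ b : A, IsSelfAdjoint b ∧ ‖a - b‖ < δ ∧ ∀ j < n, t j ∉ spectrum ℝ b := by
  induction n with
  | zero => exact ⟨a, ha, by simpa using hδ, by simp⟩
  | succ n ih =>
    obtain ⟨b, hb, hab, hn⟩ := ih
    have hopen : ∀ᶠ x in 𝓝 b, ‖a - x‖ < δ ∧
        ∀ j ∈ Finset.range n, IsUnit (algebraMap ℝ A (t j) - x) := by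
      refine Filter.Eventually.and ?_ ((Finset.eventually_all _).mpr fun j hj => ?_)
      · exact (Continuous.tendsto (f := fun x => ‖a - x‖) (by fun_prop) b).eventually_lt_const hab
      · have hu : IsUnit (algebraMap ℝ A (t j) - b) :=
          spectrum.notMem_iff.mp (hn j (Finset.mem_range.mp hj))
        exact (Continuous.tendsto (f := fun x => algebraMap ℝ A (t j) - x) (by fun_prop) b)
          |>.eventually (Units.isOpen.mem_nhds hu)
    have hsa : IsSelfAdjoint (b - algebraMap ℝ A (t n)) :=
      hb.sub (IsSelfAdjoint.algebraMap A (IsSelfAdjoint.all _))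
    have hcl := hRR (show b - algebraMap ℝ A (t n) ∈ {a : A | IsSelfAdjoint a} from hsa)
    have hsh : Tendsto (fun x => x + algebraMap ℝ A (t n)) (𝓝 (b - algebraMap ℝ A (t n)))
        (𝓝 b) := by
      have := Continuous.tendsto (f := fun x => x + algebraMap ℝ A (t n)) (by fun_prop)
        (b - algebraMap ℝ A (t n))
      simpa using this
    obtain ⟨c, ⟨hc1, hc2⟩, hcsa, hcu⟩ := mem_closure_iff_nhds.mp hcl _ (hsh hopen)
    refine ⟨c + algebraMap ℝ A (t n), hcsa.add (IsSelfAdjoint.algebraMap A (IsSelfAdjoint.all _)),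
      hc1, fun j hj => ?_⟩
    rcases Nat.lt_succ_iff_lt_or_eq.mp hj with hj | rfl
    · exact spectrum.notMem_iff.mpr (hc2 j (Finset.mem_range.mpr hj))
    · refine spectrum.notMem_iff.mpr ?_
      rw [sub_add_cancel_right]
      exact hcu.neg

theorem cfc_posPart_sub {a : A} (ha : IsSelfAdjoint a) {f : ℝ → ℝ} (hf : Continuous f) (t : ℝ) :
    cfc f (a - algebraMap ℝ A t)⁺ = cfc (fun x => f (max (x - t) 0)) a := by
  have h1 : a - algebraMap ℝ A t = cfc (fun x : ℝ => x - t) a := by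
    rw [cfc_sub (fun x => x) (fun _ => t) a, cfc_id' ℝ a, cfc_const t a]
  rw [CFC.posPart_def, cfcₙ_eq_cfc, h1, ← cfc_comp' _ _ a, ← cfc_comp' _ _ a]
  rfl

variable [PartialOrder A] [StarOrderedRing A] {τ : A →ₚ[ℂ] ℂ}

theorem neg_algebraMap_le_and_le_of_norm_le {x : A} (hx : IsSelfAdjoint x) {r : ℝ} (h : ‖x‖ ≤ r) :
    -algebraMap ℝ A r ≤ x ∧ x ≤ algebraMap ℝ A r := by
  have hr : algebraMap ℝ A ‖x‖ ≤ algebraMap ℝ A r := algebraMap_mono A h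
  exact ⟨(neg_le_neg hr).trans hx.neg_algebraMap_norm_le_self,
    hx.le_algebraMap_norm_self.trans hr⟩

/-- The cut-down of `a` at a level `t` outside its spectrum has the dimension of the spectral
projection: near the spectrum, small cutoffs coincide with the indicator function. -/
theorem dimFun_posPart_sub_eq_specProj (τ : A →ₚ[ℂ] ℂ) {a : A} (ha : IsSelfAdjoint a) {t : ℝ}
    (ht : t ∉ spectrum ℝ a) :
    dimFun τ (a - algebraMap ℝ A t)⁺ = (τ (specProj t a)).re := by
  refine tendsto_nhds_unique (tendsto_dimFun τ (CFC.posPart_nonneg _)) ?_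
  refine tendsto_const_nhds.congr' ?_
  obtain ⟨γ, hγ, hball⟩ := Metric.isOpen_iff.mp (spectrum.isClosed (𝕜 := ℝ) a).isOpen_compl t ht
  filter_upwards [Ioo_mem_nhdsGT hγ] with ε hε
  rw [cfc_posPart_sub ha (continuous_cutoff ε) t, specProj]
  congr 2
  refine cfc_congr fun x hx => ?_
  have hxt : γ ≤ |x - t| := by
    by_contra! hlt
    exact hball (by rwa [Metric.mem_ball, Real.dist_eq]) hx
  split_ifs with h
  · rw [abs_of_pos (sub_pos.mpr h)] at hxt
    exact (cutoff_of_ge hε.1 (le_max_of_le_left (by linarith [hε.2]))).symm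
  · rw [max_eq_right (by linarith)]
    exact (cutoff_of_le hε.1 (half_pos hε.1).le).symm

/-- The tail of the distribution of `a` at `t`, i.e. the dimension of `(a - t)⁺`, is bounded by
the tail at a smaller level of any nearby self-adjoint element. -/
theorem dimFun_posPart_sub_le (hτ : IsFaithfulTracialState τ) {a b : A} (ha : IsSelfAdjoint a)
    (hb : IsSelfAdjoint b) {δ s t : ℝ} (hab : ‖a - b‖ ≤ δ) (hst : s + δ ≤ t) :
    dimFun τ (a - algebraMap ℝ A t)⁺ ≤ dimFun τ (b - algebraMap ℝ A s)⁺ := by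
  have hsa : ∀ r : ℝ, IsSelfAdjoint (algebraMap ℝ A r) := fun r =>
    IsSelfAdjoint.algebraMap A (IsSelfAdjoint.all r)
  refine dimFun_posPart_mono hτ (ha.sub (hsa t)) (hb.sub (hsa s)) ?_
  have h1 := (neg_algebraMap_le_and_le_of_norm_le (ha.sub hb) hab).2
  have h2 : algebraMap ℝ A (s + δ) ≤ algebraMap ℝ A t := algebraMap_mono A hst
  rw [map_add] at h2
  calc a - algebraMap ℝ A t ≤ a - (algebraMap ℝ A s + algebraMap ℝ A δ) := by gcongr
    _ = b - algebraMap ℝ A s + (a - b) - algebraMap ℝ A δ := by abel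
    _ ≤ b - algebraMap ℝ A s + algebraMap ℝ A δ - algebraMap ℝ A δ := by gcongr
    _ = b - algebraMap ℝ A s := by abel

/-- Below the spectrum of a positive element the distribution tail is at least one. -/
theorem one_le_dimFun_of_neg (hτ : IsFaithfulTracialState τ) {a : A} (ha : 0 ≤ a) {t : ℝ}
    (ht : t < 0) : 1 ≤ dimFun τ (a - algebraMap ℝ A t)⁺ := by
  have h := re_map_cfc_cutoff_le_dimFun τ (CFC.posPart_nonneg (a - algebraMap ℝ A t))
    (neg_pos.mpr ht)
  have h1 : cfc (cutoff (-t)) (a - algebraMap ℝ A t)⁺ = 1 := by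
    rw [cfc_posPart_sub ha.isSelfAdjoint (continuous_cutoff _), ← cfc_const_one ℝ a]
    refine cfc_congr fun x hx => cutoff_of_ge (neg_pos.mpr ht) (le_max_of_le_left ?_)
    linarith [spectrum_nonneg_of_nonneg ha hx]
  rwa [h1, hτ.map_one, Complex.one_re] at h

theorem dimFun_posPart_sub_norm_le_zero (τ : A →ₚ[ℂ] ℂ) {a : A} (ha : IsSelfAdjoint a) :
    dimFun τ (a - algebraMap ℝ A ‖a‖)⁺ ≤ 0 := by
  have h0 : (a - algebraMap ℝ A ‖a‖)⁺ = 0 :=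
    (CFC.posPart_eq_zero_iff _ (ha.sub (IsSelfAdjoint.algebraMap A (IsSelfAdjoint.all _)))).mpr
      (sub_nonpos.mpr ha.le_algebraMap_norm_self)
  rw [h0]
  refine dimFun_le_of_forall_cutoff τ le_rfl fun ε hε => ?_
  have : cfc (cutoff ε) (0 : A) = 0 := by
    rw [cfc_apply_zero, cutoff_of_le hε (half_pos hε).le, map_zero]
  rw [this, map_zero, Complex.zero_re]

/-- An inequality between eigenvalue functions gives one between distribution tails, up to an
arbitrarily small shift of the level. -/
theorem dimFun_posPart_sub_le_of_eigenvalueFun_le (hτ : IsFaithfulTracialState τ) {a b : A}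
    (ha : 0 ≤ a) (hb : 0 ≤ b)
    (h : ∀ s ∈ Set.Ico (0 : ℝ) 1, eigenvalueFun τ a s ≤ eigenvalueFun τ b s) {t t' : ℝ}
    (htt' : t < t') :
    dimFun τ (a - algebraMap ℝ A t')⁺ ≤ dimFun τ (b - algebraMap ℝ A t)⁺ := by
  rcases le_or_gt 1 (dimFun τ (b - algebraMap ℝ A t)⁺) with h1 | h1
  · exact (dimFun_le_one hτ (CFC.posPart_nonneg _)).trans h1
  set s := dimFun τ (b - algebraMap ℝ A t)⁺ with hs
  have hs0 : 0 ≤ s := by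
    refine le_trans ?_ (re_map_cfc_cutoff_le_dimFun τ (CFC.posPart_nonneg _) one_pos)
    have := re_map_mono τ (cfc_nonneg (a := (b - algebraMap ℝ A t)⁺) (f := cutoff 1)
      fun x _ => le_max_left _ _)
    rwa [map_zero, Complex.zero_re] at this
  have hbdd : BddBelow {r : ℝ | dimFun τ (b - algebraMap ℝ A r)⁺ ≤ s} := by
    refine ⟨0, fun r hr => ?_⟩
    by_contra! hneg
    exact absurd ((one_le_dimFun_of_neg hτ hb hneg).trans hr) (not_le.mpr h1)
  have hbt : eigenvalueFun τ b s ≤ t := csInf_le hbdd hs.ge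
  have hne : {r : ℝ | dimFun τ (a - algebraMap ℝ A r)⁺ ≤ s}.Nonempty :=
    ⟨‖a‖, (dimFun_posPart_sub_norm_le_zero τ ha.isSelfAdjoint).trans hs0⟩
  obtain ⟨r, hr, hrt⟩ := exists_lt_of_csInf_lt hne (((h s ⟨hs0, h1⟩).trans hbt).trans_lt htt')
  refine le_trans ?_ hr
  exact dimFun_posPart_sub_le (δ := 0) hτ ha.isSelfAdjoint ha.isSelfAdjoint (by simp)
    (by linarith)

/-- A positive element is approximated by a combination of spectral projections along a grid of
mesh `h` whose traces are controlled by the distribution tails of the element. -/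
theorem RealRankZero.exists_projections (hRR : RealRankZero A) (hτ : IsFaithfulTracialState τ)
    {a : A} (ha : 0 ≤ a) {h c δ : ℝ} (hh : 0 < h) (hc : 0 ≤ c) (hδ : 0 < δ) :
    ∃ P : ℕ → A, (∀ j, IsStarProjection (P j)) ∧ Antitone P ∧
      (∀ j : ℕ, (τ (P j)).re ≤ dimFun τ (a - algebraMap ℝ A (c + j * h - δ))⁺) ∧
      (∀ j : ℕ, dimFun τ (a - algebraMap ℝ A (c + j * h + δ))⁺ ≤ (τ (P j)).re) ∧
      ∀ᶠ n in atTop, ‖a - h • ∑ j ∈ Finset.range n, P j‖ ≤ 2 * c + h + 2 * δ := by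
  obtain ⟨N, hN⟩ := exists_nat_gt ((‖a‖ + δ) / h)
  have hN' : ∀ n, N ≤ n → ‖a‖ + δ < n * h := fun n hn => by
    rw [div_lt_iff₀ hh] at hN
    have : (N : ℝ) ≤ n := by exact_mod_cast hn
    nlinarith
  obtain ⟨b, hb, hab, hgapN⟩ := hRR.exists_norm_sub_lt_notMem_spectrum ha.isSelfAdjoint hδ
    (fun j => c + j * h) N
  have hab' := neg_algebraMap_le_and_le_of_norm_le (ha.isSelfAdjoint.sub hb) hab.le
  have hhi : ∀ x ∈ spectrum ℝ b, x ≤ ‖a‖ + δ := by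
    refine (le_algebraMap_iff_spectrum_le hb).mp ?_
    calc b = a - (a - b) := by abel
      _ ≤ algebraMap ℝ A ‖a‖ - -algebraMap ℝ A δ :=
        sub_le_sub ha.isSelfAdjoint.le_algebraMap_norm_self hab'.1
      _ = algebraMap ℝ A (‖a‖ + δ) := by rw [map_add]; abel
  have hlo : ∀ x ∈ spectrum ℝ b, -δ ≤ x := by
    refine (algebraMap_le_iff_le_spectrum hb).mp ?_
    calc algebraMap ℝ A (-δ) = 0 - algebraMap ℝ A δ := by rw [map_neg, zero_sub]
      _ ≤ a - (a - b) := sub_le_sub ha hab'.2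
      _ = b := by abel
  have hgap : ∀ j : ℕ, c + j * h ∉ spectrum ℝ b := fun j => by
    rcases lt_or_ge j N with hj | hj
    · exact hgapN j hj
    · intro hx
      linarith [hhi _ hx, hN' j hj]
  have hba : ‖b - a‖ ≤ δ := by rw [norm_sub_rev]; exact hab.le
  refine ⟨fun j => specProj (c + j * h) b, fun j => isStarProjection_specProj (hgap j),
    fun i j hij => specProj_anti (by gcongr) (hgap i) (hgap j), fun j => ?_, fun j => ?_, ?_⟩
  · rw [← dimFun_posPart_sub_eq_specProj τ hb (hgap j)]
    exact dimFun_posPart_sub_le hτ hb ha.isSelfAdjoint hba (by linarith)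
  · rw [← dimFun_posPart_sub_eq_specProj τ hb (hgap j)]
    exact dimFun_posPart_sub_le hτ ha.isSelfAdjoint hb hab.le (by linarith)
  · filter_upwards [eventually_ge_atTop N] with n hn
    have h1 := norm_sub_sum_specProj_le (e := c + δ) hb hh (by positivity) hc hgap n
      (fun x hx => by linarith [hlo x hx]) (fun x hx => by linarith [hhi x hx, hN' n hn])
    calc ‖a - h • ∑ j ∈ Finset.range n, specProj (c + j * h) b‖
        = ‖(a - b) + (b - h • ∑ j ∈ Finset.range n, specProj (c + j * h) b)‖ := by
          rw [sub_add_sub_cancel]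
      _ ≤ ‖a - b‖ + ‖b - h • ∑ j ∈ Finset.range n, specProj (c + j * h) b‖ := norm_add_le _ _
      _ ≤ 2 * c + h + 2 * δ := by linarith

/-- Telescoping: if `P (j + 1) ≤ R j ≤ P j` for projections `P j`, then the partial sums of `P`
and `R` differ by at most the first projection. -/
theorem norm_sum_sub_sum_le_one {P R : ℕ → A} (hP : ∀ j, IsStarProjection (P j)) (n : ℕ)
    (h : ∀ j < n, P (j + 1) ≤ R j ∧ R j ≤ P j) :
    ‖∑ j ∈ Finset.range n, P j - ∑ j ∈ Finset.range n, R j‖ ≤ 1 := by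
  rw [← Finset.sum_sub_distrib]
  have h0 : 0 ≤ ∑ j ∈ Finset.range n, (P j - R j) :=
    Finset.sum_nonneg fun j hj => sub_nonneg.mpr (h j (Finset.mem_range.mp hj)).2
  rw [CStarAlgebra.norm_le_one_iff_of_nonneg _ h0]
  calc ∑ j ∈ Finset.range n, (P j - R j) ≤ ∑ j ∈ Finset.range n, (P j - P (j + 1)) :=
        Finset.sum_le_sum fun j hj => sub_le_sub_left (h j (Finset.mem_range.mp hj)).1 _
    _ = P 0 - P n := Finset.sum_range_sub' P n
    _ ≤ P 0 := sub_le_self _ (hP n).nonneg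
    _ ≤ 1 := (hP 0).le_one

/-- Positive elements with the same eigenvalue function are approximately unitarily
equivalent. -/
theorem exists_unitary_norm_sub_conj_lt (hτ : IsFaithfulTracialState τ) (hRR : RealRankZero A)
    (hcomp : StrongComparison τ) {a b : A} (ha : 0 ≤ a) (hb : 0 ≤ b)
    (h : ∀ s ∈ Set.Ico (0 : ℝ) 1, eigenvalueFun τ a s = eigenvalueFun τ b s) {ε : ℝ}
    (hε : 0 < ε) : ∃ u ∈ unitary A, ‖a - u * b * star u‖ < ε := by
  -- The grid for `b` is shifted by half a mesh against that for `a`, and the perturbations are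
  -- smaller than a quarter mesh, so that the traces interlace.
  set δ := ε / 60 with hδ
  have hδ0 : 0 < δ := by positivity
  obtain ⟨P, hP, hPa, hP1, hP2, hP3⟩ := hRR.exists_projections hτ ha (h := 6 * δ) (c := 0)
    (by positivity) le_rfl hδ0
  obtain ⟨Q, hQ, hQa, hQ1, hQ2, hQ3⟩ := hRR.exists_projections hτ hb (h := 6 * δ) (c := 3 * δ)
    (by positivity) (by positivity) hδ0
  obtain ⟨n, hn1, hn2⟩ := (hP3.and hQ3).exists
  have hPQ : ∀ j, (τ (P (j + 1))).re ≤ (τ (Q j)).re := fun j =>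
    (hP1 (j + 1)).trans ((dimFun_posPart_sub_le_of_eigenvalueFun_le hτ ha hb
      (fun s hs => (h s hs).le) (by push_cast; linarith)).trans (hQ2 j))
  have hQP : ∀ j, (τ (Q j)).re ≤ (τ (P j)).re := fun j =>
    (hQ1 j).trans ((dimFun_posPart_sub_le_of_eigenvalueFun_le hτ hb ha
      (fun s hs => (h s hs).ge) (by linarith)).trans (hP2 j))
  obtain ⟨u, hu, hI⟩ := hcomp.exists_unitary_interlace hτ hP hQ hPa hQa hPQ hQP n
  refine ⟨u, hu, ?_⟩
  have h1 := norm_sum_sub_sum_le_one hP n hI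
  set p := ∑ j ∈ Finset.range n, P j
  set q := ∑ j ∈ Finset.range n, Q j with hq
  rw [← Finset.sum_mul, ← Finset.mul_sum, ← hq] at h1
  have h2 : ‖u * (b - (6 * δ) • q) * star u‖ = ‖b - (6 * δ) • q‖ := by
    rw [CStarRing.norm_mul_mem_unitary _ (Unitary.star_mem hu),
      CStarRing.norm_mem_unitary_mul _ hu]
  have h3 : a - u * b * star u = (a - (6 * δ) • p) + (6 * δ) • (p - u * q * star u) -
      u * (b - (6 * δ) • q) * star u := by
    simp only [smul_sub, mul_sub, sub_mul, mul_smul_comm, smul_mul_assoc]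
    abel
  have h4 : ‖(6 * δ) • (p - u * q * star u)‖ ≤ 6 * δ := by
    rw [norm_smul, Real.norm_of_nonneg (by positivity)]
    nlinarith
  rw [h3]
  calc _ ≤ ‖a - (6 * δ) • p‖ + ‖(6 * δ) • (p - u * q * star u)‖ +
        ‖u * (b - (6 * δ) • q) * star u‖ := (norm_sub_le _ _).trans (by gcongr; exact norm_add_le _ _)
    _ < ε := by rw [h2]; linarith

end Spectral

/-! ### Polar decomposition and the two-sided unitary orbit -/

section Orbit

variable {A : Type*} [CStarAlgebra A]

theorem cfc_unitary_conj {a u : A} (ha : IsSelfAdjoint a) (hu : u ∈ unitary A) {f : ℝ → ℝ}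
    (hf : Continuous f) : cfc f (u * a * star u) = u * cfc f a * star u := by
  have hφ : Continuous (Unitary.conjStarAlgAut ℝ A ⟨u, hu⟩) := by
    change Continuous fun x => u * x * star u
    fun_prop
  exact (StarAlgHomClass.map_cfc (Unitary.conjStarAlgAut ℝ A ⟨u, hu⟩) f a hf.continuousOn hφ ha
    (ha.conjugate' (star u) |> fun h => by simpa using h)).symm

variable [PartialOrder A] [StarOrderedRing A] {τ : A →ₚ[ℂ] ℂ}

theorem abs_unitary_mul_mul_unitary {U V : A} (hU : U ∈ unitary A) (hV : V ∈ unitary A) (T : A) :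
    CFC.abs (U * T * V) = star V * CFC.abs T * V := by
  refine (CFC.sqrt_eq_iff _ _ (star_mul_self_nonneg _)
    (star_left_conjugate_nonneg (CFC.abs_nonneg T) V)).mpr ?_
  calc star V * CFC.abs T * V * (star V * CFC.abs T * V)
      = star V * CFC.abs T * (V * star V) * CFC.abs T * V := by simp only [mul_assoc]
    _ = star V * (CFC.abs T * CFC.abs T) * V := by
      rw [(Unitary.mem_iff.mp hV).2, mul_one]; simp only [mul_assoc]
    _ = star V * (star T * (star U * U) * T) * V := by
      rw [CFC.abs_mul_abs, (Unitary.mem_iff.mp hU).1, mul_one]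
    _ = star (U * T * V) * (U * T * V) := by simp only [star_mul, mul_assoc]

theorem continuous_map_cfc_abs (τ : A →ₚ[ℂ] ℂ) {f : ℝ → ℝ} (hf : Continuous f) :
    Continuous fun x : A => τ (cfc f (CFC.abs x)) := by
  have h : Continuous fun x : A => cfc f (CFC.abs x) :=
    Continuous.cfc_of_mem_nhdsSet (s := Set.univ) f Filter.univ_mem CFC.continuous_abs
      (fun x => (CFC.abs_nonneg x).isSelfAdjoint) hf.continuousOn
  exact (map_continuous τ).comp h

/-- On the closed two-sided unitary orbit of `T`, the trace of a continuous function of the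
absolute value is constant: it is so on the orbit, and it is continuous. -/
theorem IsFaithfulTracialState.map_cfc_abs_eq (hτ : IsFaithfulTracialState τ) {S T : A}
    (h : S ∈ closedTwoSidedUnitaryOrbit T) {f : ℝ → ℝ} (hf : Continuous f) :
    τ (cfc f (CFC.abs S)) = τ (cfc f (CFC.abs T)) := by
  refine closure_minimal (s := {x : A | ∃ U ∈ unitary A, ∃ V ∈ unitary A, x = U * T * V})
    (t := {x : A | τ (cfc f (CFC.abs x)) = τ (cfc f (CFC.abs T))}) ?_
    (isClosed_eq (continuous_map_cfc_abs τ hf) continuous_const) h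
  rintro _ ⟨U, hU, V, hV, rfl⟩
  have h1 := cfc_unitary_conj (CFC.abs_nonneg T).isSelfAdjoint (Unitary.star_mem hV) hf
  have h2 := hτ.map_unitary_conj (Unitary.star_mem hV) (cfc f (CFC.abs T))
  rw [← h1, star_star, ← abs_unitary_mul_mul_unitary hU hV] at h2
  exact h2

theorem singularValueFun_eq_of_mem_orbit (hτ : IsFaithfulTracialState τ) {S T : A}
    (h : S ∈ closedTwoSidedUnitaryOrbit T) : singularValueFun τ S = singularValueFun τ T := by
  have hdim : ∀ t : ℝ, dimFun τ (CFC.abs S - algebraMap ℝ A t)⁺ =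
      dimFun τ (CFC.abs T - algebraMap ℝ A t)⁺ := fun t => by
    unfold dimFun
    congr 1
    funext ε
    rw [cfc_posPart_sub (CFC.abs_nonneg S).isSelfAdjoint (continuous_cutoff ε),
      cfc_posPart_sub (CFC.abs_nonneg T).isSelfAdjoint (continuous_cutoff ε),
      hτ.map_cfc_abs_eq h (f := fun x => cutoff ε (max (x - t) 0))
        ((continuous_cutoff ε).comp (by fun_prop))]
  funext s
  simp only [singularValueFun, eigenvalueFun, hdim]

/-- Polar decomposition of an invertible element. -/
theorem exists_unitary_eq_mul_abs {a : A} (ha : IsUnit a) : ∃ u ∈ unitary A, a = u * CFC.abs a := by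
  have habs : IsUnit (CFC.abs a) := by
    rw [← isUnit_pow_iff two_ne_zero, CFC.abs_sq]
    exact ha.star.mul ha
  obtain ⟨r, hr⟩ := habs
  have hs : star (CFC.abs a) = CFC.abs a := (CFC.abs_nonneg a).star_eq
  have hrs : star (↑r⁻¹ : A) = ↑r⁻¹ := by
    rw [← hr] at hs
    have : star r = r := Units.ext hs
    rw [← Units.coe_star, star_inv, this]
  refine ⟨a * ↑r⁻¹, ?_, by rw [← hr, mul_assoc, Units.inv_mul, mul_one]⟩
  have hu : IsUnit (a * ↑r⁻¹) := ha.mul r⁻¹.isUnit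
  have h1 : star (a * ↑r⁻¹) * (a * ↑r⁻¹) = 1 := by
    calc star (a * ↑r⁻¹) * (a * ↑r⁻¹) = ↑r⁻¹ * (star a * a) * ↑r⁻¹ := by
          rw [star_mul, hrs]; simp only [mul_assoc]
      _ = ↑r⁻¹ * (↑r * ↑r) * (↑r⁻¹ : A) := by rw [← CFC.abs_mul_abs, hr]
      _ = 1 := by rw [← mul_assoc, Units.inv_mul, one_mul, Units.mul_inv]
  refine Unitary.mem_iff.mpr ⟨h1, ?_⟩
  -- A left inverse of an invertible element is its inverse.
  refine hu.mul_right_cancel ?_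
  rw [mul_assoc, h1, mul_one, one_mul]

/-- In stable rank one every element has a polar decomposition with a unitary, up to an
arbitrarily small error. -/
theorem StableRankOne.exists_unitary_norm_sub_mul_abs_lt (hSR : StableRankOne A) (a : A) {ε : ℝ}
    (hε : 0 < ε) : ∃ u ∈ unitary A, ‖a - u * CFC.abs a‖ < ε := by
  have hcont : Tendsto (fun x : A => ‖a - x‖ + ‖CFC.abs x - CFC.abs a‖) (𝓝 a) (𝓝 0) := by
    have hc : Continuous fun x : A => ‖a - x‖ + ‖CFC.abs x - CFC.abs a‖ :=
      (continuous_const.sub continuous_id).norm.add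
        (CFC.continuous_abs.sub continuous_const).norm
    simpa using hc.tendsto a
  obtain ⟨x, hx, hxu⟩ := mem_closure_iff_nhds.mp (hSR a) _ (hcont.eventually_lt_const hε)
  obtain ⟨u, hu, hpol⟩ := exists_unitary_eq_mul_abs hxu
  refine ⟨u, hu, lt_of_le_of_lt ?_ hx⟩
  calc ‖a - u * CFC.abs a‖ = ‖(a - x) + u * (CFC.abs x - CFC.abs a)‖ := by
        rw [mul_sub, ← hpol, sub_add_sub_cancel]
    _ ≤ ‖a - x‖ + ‖u * (CFC.abs x - CFC.abs a)‖ := norm_add_le _ _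
    _ = ‖a - x‖ + ‖CFC.abs x - CFC.abs a‖ := by rw [CStarRing.norm_mem_unitary_mul _ hu]

end Orbit

end TracialCStar

theorem mainTheorem8 {A : Type*} [CStarAlgebra A] [PartialOrder A] [StarOrderedRing A]
    (τ : A →ₚ[ℂ] ℂ) (hτ : TracialCStar.IsFaithfulTracialState τ)
    (hRR : TracialCStar.RealRankZero A) (hSR : TracialCStar.StableRankOne A)
    (hcomp : TracialCStar.StrongComparison τ) (S T : A) :
    S ∈ TracialCStar.closedTwoSidedUnitaryOrbit T ↔
      ∀ s ∈ Set.Ico (0 : ℝ) 1,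
        TracialCStar.singularValueFun τ S s = TracialCStar.singularValueFun τ T s := by
  constructor
  · intro h s _
    rw [TracialCStar.singularValueFun_eq_of_mem_orbit hτ h]
  · intro h
    refine Metric.mem_closure_iff.mpr fun ε hε => ?_
    have hε3 : 0 < ε / 3 := by positivity
    obtain ⟨w, hw, hS⟩ := hSR.exists_unitary_norm_sub_mul_abs_lt S hε3
    obtain ⟨v, hv, hT⟩ := hSR.exists_unitary_norm_sub_mul_abs_lt T hε3
    obtain ⟨u, hu, hST⟩ := TracialCStar.exists_unitary_norm_sub_conj_lt hτ hRR hcomp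
      (CFC.abs_nonneg S) (CFC.abs_nonneg T) h hε3
    have hu' := Unitary.star_mem hu
    have hv' := Unitary.star_mem hv
    -- `S ≈ w |S| ≈ w u |T| u* ≈ (w u v*) T u*`
    refine ⟨w * u * star v * T * star u,
      ⟨_, mul_mem (mul_mem hw hu) hv', _, hu', rfl⟩, ?_⟩
    have hvT : ∀ x, star v * (v * x) = x := fun x => by
      rw [← mul_assoc, (Unitary.mem_iff.mp hv).1, one_mul]
    have key : S - w * u * star v * T * star u = (S - w * CFC.abs S) +
        w * (CFC.abs S - u * CFC.abs T * star u) -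
        w * u * star v * (T - v * CFC.abs T) * star u := by
      simp only [mul_sub, sub_mul, mul_assoc, hvT]
      abel
    have h1 : ‖w * (CFC.abs S - u * CFC.abs T * star u)‖ < ε / 3 := by
      rwa [CStarRing.norm_mem_unitary_mul _ hw]
    have h2 : ‖w * u * star v * (T - v * CFC.abs T) * star u‖ < ε / 3 := by
      rwa [CStarRing.norm_mul_mem_unitary _ hu',
        CStarRing.norm_mem_unitary_mul _ (mul_mem (mul_mem hw hu) hv')]
    rw [dist_eq_norm, key]
    calc _ ≤ ‖S - w * CFC.abs S‖ + ‖w * (CFC.abs S - u * CFC.abs T * star u)‖ +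
          ‖w * u * star v * (T - v * CFC.abs T) * star u‖ :=
          (norm_sub_le _ _).trans (by gcongr; exact norm_add_le _ _)
      _ < ε := by linarith
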